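/- Let $\mathsf A$ be an abelian category with enough projective objects, and let $\mathsf B\subset\mathsf A$ be a full subcategory closed under kernels and cokernels in $\mathsf A$ (that is, every kernel and every cokernel in $\mathsf A$ of a morphism between objects of $\mathsf B$ belongs to $\mathsf B$). Assume that the fully faithful embedding functor $\mathsf B\to\mathsf A$ has a left adjoint functor $\Delta\colon\mathsf A\to\mathsf B$. Then $\mathsf B$ is an abelian category, the embedding $\mathsf B\to\mathsf A$ is exact, and $\Delta$ is additive and right exact. For $n\ge0$, let $\mathbb L_n\Delta\colon\mathsf A\to\mathsf B$ denote the $n$-th left derived functor of $\Delta$, computed by projective resolutions in $\mathsf A$. For an abelian category $\mathsf C$, let $\mathsf D^-(\mathsf C)$ and $\mathsf D^{\mathrm b}(\mathsf C)$ denote its bounded above and its bounded derived category (cohomological grading). The following four conditions are equivalent: (a) $\mathbb L_n\Delta(P)=0$ for every projective object $P$ of the category $\mathsf B$ (regarded as an object of $\mathsf A$) and all $n\ge1$; (b) $\mathbb L_n\Delta(B)=0$ for every object $B\in\mathsf B$ and all $n\ge1$; (c) the triangulated functor $\mathsf D^-(\mathsf B)\to\mathsf D^-(\mathsf A)$ induced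 by the exact embedding functor $\mathsf B\to\mathsf A$ is fully faithful; (d) the triangulated functor $\mathsf D^{\mathrm b}(\mathsf B)\to\mathsf D^{\mathrm b}(\mathsf A)$ induced by the exact embedding functor $\mathsf B\to\mathsf A$ is fully faithful. -/

import Mathlib

open CategoryTheory CategoryTheory.Limits

universe w₁ w₂ v₁ v₂ u₁ u₂ v u

namespace ReflectiveAbelian

section Subcategory

open scoped ZeroObject

variable {A : Type u} [Category.{v} A] [Abelian A] (B : ObjectProperty A)

/-- A full subcategory closed under kernels is closed under isomorphisms: if `X ≅ Y` with `X` in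
`B`, then `Y` is a kernel of the zero endomorphism of `X`. -/
instance isClosedUnderIsomorphisms [B.IsClosedUnderKernels] : B.IsClosedUnderIsomorphisms where
  of_iso {X Y} e hX := by
    have hk : IsLimit (KernelFork.ofι (f := (0 : X ⟶ X)) e.inv (by simp)) :=
      KernelFork.IsLimit.ofι _ _ (fun g _ => g ≫ e.hom) (fun g _ => by simp)
        (fun g _ m hm => by simp [← hm])
    exact B.prop_of_isLimit_kernelFork hk hX hX

/-- A reflective full subcategory closed under kernels is nonempty, and hence contains the kernel
of an identity morphism, which is a zero object. -/
instance containsZero [B.IsClosedUnderKernels] [Reflective B.ι] : B.ContainsZero where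
  exists_zero := by
    let X : B.FullSubcategory := (reflector B.ι).obj 0
    exact ⟨kernel (𝟙 X.obj), (isZero_zero A).of_iso (kernel.ofMono (𝟙 X.obj)),
      B.prop_kernel _ X.property X.property⟩

/-- A reflective full subcategory closed under isomorphisms is closed under finite products. -/
instance isClosedUnderFiniteProducts [B.IsClosedUnderKernels] [Reflective B.ι] :
    B.IsClosedUnderFiniteProducts where
  isClosedUnderLimitsOfShape J _ := by
    have : HasLimitsOfShape (Discrete J) B.FullSubcategory := hasLimitsOfShape_of_reflective B.ι
    have : PreservesLimitsOfShape (Discrete J) B.ι :=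
      (reflectorAdjunction B.ι).rightAdjoint_preservesLimits.preservesLimitsOfShape
    exact B.isClosedUnderLimitsOfShape_of_preservesLimitsOfShape_ι _

/-- The embedding of a reflective full subcategory is left exact. -/
instance preservesFiniteLimits [Reflective B.ι] : PreservesFiniteLimits B.ι := by
  have : PreservesLimitsOfSize.{0, 0} B.ι :=
    (reflectorAdjunction B.ι).rightAdjoint_preservesLimits
  exact PreservesLimitsOfSize.preservesFiniteLimits B.ι

/-- The embedding of a reflective full subcategory closed under kernels and cokernels is right
exact. -/
instance preservesFiniteColimits [B.IsClosedUnderKernels] [B.IsClosedUnderCokernels]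
    [Reflective B.ι] : PreservesFiniteColimits B.ι := by
  have := B.preservesCokernels_ι
  exact Functor.preservesFiniteColimits_of_preservesCokernels B.ι

/-- The left adjoint of the embedding is additive. -/
instance reflector_additive [B.IsClosedUnderKernels] [B.IsClosedUnderCokernels]
    [Reflective B.ι] : (reflector B.ι).Additive :=
  (reflectorAdjunction B.ι).left_adjoint_additive

end Subcategory

section Derived

open DerivedCategory

variable {C₁ : Type u₁} [Category.{v₁} C₁] [Abelian C₁] [HasDerivedCategory.{w₁} C₁]
  {C₂ : Type u₂} [Category.{v₂} C₂] [Abelian C₂] [HasDerivedCategory.{w₂} C₂]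
  (F : C₁ ⥤ C₂) [F.Additive] [PreservesFiniteLimits F] [PreservesFiniteColimits F]

/-- The functor between derived categories induced by an exact functor preserves complexes whose
cohomology is concentrated in degrees `≤ n`. -/
theorem isLE_mapDerivedCategory (X : DerivedCategory C₁) (n : ℤ) (h : TStructure.t.IsLE X n) :
    TStructure.t.IsLE (F.mapDerivedCategory.obj X) n := by
  obtain ⟨K, hK, ⟨e⟩⟩ := X.exists_iso_Q_obj_of_isLE n
  exact ⟨⟨(F.mapHomologicalComplex (ComplexShape.up ℤ)).obj K,
    F.mapDerivedCategory.mapIso e ≪≫ F.mapDerivedCategoryFactors.app K, inferInstance⟩⟩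

/-- The functor between derived categories induced by an exact functor preserves complexes whose
cohomology is concentrated in degrees `≥ n`. -/
theorem isGE_mapDerivedCategory (X : DerivedCategory C₁) (n : ℤ) (h : TStructure.t.IsGE X n) :
    TStructure.t.IsGE (F.mapDerivedCategory.obj X) n := by
  obtain ⟨K, hK, ⟨e⟩⟩ := X.exists_iso_Q_obj_of_isGE n
  exact ⟨⟨(F.mapHomologicalComplex (ComplexShape.up ℤ)).obj K,
    F.mapDerivedCategory.mapIso e ≪≫ F.mapDerivedCategoryFactors.app K, inferInstance⟩⟩

/-- The functor `D⁻(C₁) ⥤ D⁻(C₂)` induced by an exact functor `F : C₁ ⥤ C₂`. -/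
noncomputable def mapDerivedMinus : DerivedCategory.Minus C₁ ⥤ DerivedCategory.Minus C₂ :=
  ObjectProperty.lift _ (Minus.ι ⋙ F.mapDerivedCategory)
    (fun X => X.property.elim fun n hn => ⟨n, isLE_mapDerivedCategory F X.obj n hn⟩)

/-- The functor `Dᵇ(C₁) ⥤ Dᵇ(C₂)` induced by an exact functor `F : C₁ ⥤ C₂`. -/
noncomputable def mapDerivedBounded : DerivedCategory.Bounded C₁ ⥤ DerivedCategory.Bounded C₂ :=
  ObjectProperty.lift _ (Bounded.ι ⋙ F.mapDerivedCategory)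
    (fun X => ⟨X.property.1.elim fun n hn => ⟨n, isGE_mapDerivedCategory F X.obj n hn⟩,
      X.property.2.elim fun n hn => ⟨n, isLE_mapDerivedCategory F X.obj n hn⟩⟩)

end Derived

end ReflectiveAbelian

/-!
Write `F` for the embedding of `B` and `Δ` for its left adjoint. If the left derived functors of `Δ`
vanish on a projective object `P` of `B`, then `Δ` carries a projective resolution of `F P` to one
of `P`, so by adjunction `Extⁿ(F P, F Y) ≅ Extⁿ(P, Y) = 0` for `n ≥ 1`.

Let `E` be a bounded above complex of such projective objects and `p : P ⟶ F E` a resolution by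
projective objects of `A`. The cone of `p` is acyclic, bounded above, and has no higher `Ext` into
the image of `F`, so it stays exact under `Hom(-, F Y) = Hom(Δ -, Y)`; hence `Δ P ⟶ Δ F E = E` is a
quasi-isomorphism. A morphism `F E ⟶ F L` in the derived category is then a homotopy class of maps
`P ⟶ F L`, equivalently of maps `Δ P ⟶ L`, which is a morphism `E ⟶ L` in the derived category.

Conversely, if every class in `Extⁿ(F X, F Y)` with `n ≥ 1` comes from `Extⁿ(X, Y)`, it is killed by
some monomorphism `Y ⟶ Y'`, because `B` has enough projective objects. So, for a projective
resolution `R` of `F X`, every cocycle `Rₙ ⟶ F Y` becomes a coboundary in `F Y'`. By adjunction this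
applies to `Y = coker (Δ Rₙ₊₁ ⟶ Δ Rₙ)`, where it says that `Δ R` is exact in degree `n`.
-/

universe w w'

namespace ReflectiveAbelian

section FullyFaithful

variable {C : Type u₁} [Category.{v₁} C] {D : Type u₂} [Category.{v₂} D]

lemma map_bijective_of_iso (F : C ⥤ D) {X X' Y Y' : C} (e : X ≅ X') (e' : Y ≅ Y')
    (h : Function.Bijective (F.map : (X ⟶ Y) → _)) :
    Function.Bijective (F.map : (X' ⟶ Y') → _) := by
  have hF : (F.map : (X' ⟶ Y') → _) =
      (F.mapIso e).homCongr (F.mapIso e') ∘ F.map ∘ (e.homCongr e').symm := by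
    ext f
    simp
  rw [hF]
  exact (Equiv.bijective _).comp (h.comp (Equiv.bijective _))

lemma full_and_faithful_lift_ι_comp_iff {P : ObjectProperty C} {Q : ObjectProperty D} (F : C ⥤ D)
    (hF : ∀ X, Q ((P.ι ⋙ F).obj X)) :
    (Q.lift (P.ι ⋙ F) hF).Full ∧ (Q.lift (P.ι ⋙ F) hF).Faithful ↔
      ∀ X Y : C, P X → P Y → Function.Bijective (F.map : (X ⟶ Y) → _) := by
  have hmap (X Y : P.FullSubcategory) :
      Function.Bijective ((Q.lift (P.ι ⋙ F) hF).map : (X ⟶ Y) → _) ↔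
        Function.Bijective (F.map : (X.obj ⟶ Y.obj) → _) := by
    rw [← (P.fullyFaithfulι.homEquiv.bijective).of_comp_iff,
      ← (Q.fullyFaithfulι.homEquiv.bijective).of_comp_iff']
    rfl
  refine ⟨fun ⟨_, _⟩ X Y hX hY => ?_, fun h => ?_⟩
  · exact (hmap ⟨X, hX⟩ ⟨Y, hY⟩).1 ((Functor.FullyFaithful.ofFullyFaithful _).map_bijective _ _)
  · have hbij (X Y : P.FullSubcategory) := (hmap X Y).2 (h _ _ X.property Y.property)
    exact ⟨⟨fun {X Y} => (hbij X Y).surjective⟩, ⟨fun {X Y} => @(hbij X Y).injective⟩⟩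

end FullyFaithful

section ProjectiveResolution

open Opposite CochainComplex

variable {C : Type u} [Category.{v} C] [Abelian C]

lemma quasiIso_unop_opEquivalence_inverse_map {K L : CochainComplex Cᵒᵖ ℤ} (f : K ⟶ L)
    [QuasiIso f] : QuasiIso ((opEquivalence C).inverse.map f).unop where
  quasiIsoAt n := by
    have hf : QuasiIsoAt f (-n) := inferInstance
    rw [quasiIsoAt_iff' _ (-(n + 1)) (-n) (-(n - 1)) (by simp; lia) (by simp; lia)] at hf
    rw [quasiIsoAt_iff' _ (n - 1) n (n + 1) (by simp) (by simp)]
    exact (ShortComplex.quasiIso_opMap_iff _).1 hf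

lemma exists_quasiIso_of_projective [EnoughProjectives C] (K : CochainComplex C ℤ) (N : ℤ)
    [K.IsStrictlyLE N] :
    ∃ (P : CochainComplex C ℤ) (p : P ⟶ K),
      QuasiIso p ∧ (∀ n, Projective (P.X n)) ∧ P.IsStrictlyLE N := by
  let e := opEquivalence C
  have : (e.functor.obj (op K)).IsStrictlyGE (-N) := by
    rw [isStrictlyGE_iff]
    exact fun i hi => (K.isZero_of_isStrictlyLE N (-i) (by lia)).op
  obtain ⟨I, i, hi, hI, hIN⟩ :=
    Plus.modelCategoryQuillen.exists_quasiIso_injective (e.functor.obj (op K)) (-N)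
  refine ⟨(e.inverse.obj I).unop, (e.inverse.map i).unop ≫ (e.unitIso.hom.app (op K)).unop,
    ?_, fun n => ?_, ?_⟩
  · have := quasiIso_unop_opEquivalence_inverse_map i
    infer_instance
  · exact Injective.projective_iff_injective_op.2 (hI (-n))
  · rw [isStrictlyLE_iff]
    exact fun n hn => (I.isZero_of_isStrictlyGE (-N) (-n) (by lia)).unop

end ProjectiveResolution

section EnoughProjectives

lemma enoughProjectives_of_faithful {A : Type u₁} [Category.{v₁} A] [EnoughProjectives A]
    {B : Type u₂} [Category.{v₂} B] {F : B ⥤ A} {G : A ⥤ B} (adj : G ⊣ F) [F.Faithful]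
    [F.PreservesEpimorphisms] : EnoughProjectives B where
  presentation X := ⟨
    { p := G.obj (Projective.over (F.obj X))
      projective := adj.map_projective _ inferInstance
      f := G.map (Projective.π (F.obj X)) ≫ adj.counit.app X
      epi := by
        have := Functor.preservesEpimorphisms_of_adjunction adj
        infer_instance }⟩

end EnoughProjectives

section ExtAcyclic

open Abelian

variable {C : Type u} [Category.{v} C] [Abelian C]

lemma iCycles_comp_toCycles (K : CochainComplex C ℤ) (i j : ℤ) :
    K.iCycles i ≫ K.toCycles i j = 0 := by
  rw [← cancel_mono (K.iCycles j)]
  simp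

lemma shortExact_iCycles_toCycles (K : CochainComplex C ℤ) (i j : ℤ) (hij : i + 1 = j)
    (hK : K.ExactAt j) :
    (ShortComplex.mk (K.iCycles i) (K.toCycles i j) (iCycles_comp_toCycles K i j)).ShortExact where
  exact := by
    apply ShortComplex.exact_of_f_is_kernel
    exact isKernelOfComp (K.iCycles j) (K.d i j) (K.cyclesIsKernel i j (by simp [hij]))
      (iCycles_comp_toCycles K i j) (by simp)
  mono_f := by dsimp; infer_instance
  epi_g := by
    obtain rfl : (ComplexShape.up ℤ).prev j = i := by simp [← hij]
    exact ShortComplex.Exact.epi_toCycles hK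

variable [HasExt.{w₁} C]

lemma subsingleton_ext_cycles (K : CochainComplex C ℤ) (N : ℤ) [K.IsStrictlyLE N] (hK : K.Acyclic)
    (T : C) (hT : ∀ (i : ℤ) (n : ℕ), Subsingleton (Ext (K.X i) T (n + 1))) (i : ℤ) (n : ℕ) :
    Subsingleton (Ext (K.cycles i) T (n + 1)) := by
  induction hd : (N + 1 - i).toNat generalizing i n with
  | zero =>
    have : Projective (K.cycles i) :=
      ((K.isZero_of_isStrictlyLE N i (by lia)).of_mono (K.iCycles i)).projective
    exact Ext.subsingleton_of_projective _ _ _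
  | succ d ih =>
    have hS := shortExact_iCycles_toCycles K i (i + 1) rfl (hK _)
    refine subsingleton_of_forall_eq 0 fun x => ?_
    have := hT i n
    have := ih (i + 1) (n + 1) (by lia)
    obtain ⟨y, rfl⟩ := Ext.contravariant_sequence_exact₁ hS _ x (Nat.add_comm 1 (n + 1))
      (Subsingleton.elim _ _)
    rw [Subsingleton.elim y 0, Ext.comp_zero]

lemma exists_d_comp_eq (K : CochainComplex C ℤ) (N : ℤ) [K.IsStrictlyLE N] (hK : K.Acyclic)
    (T : C) (hT : ∀ (i : ℤ) (n : ℕ), Subsingleton (Ext (K.X i) T (n + 1)))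
    {l n m : ℤ} (hl : l + 1 = n) (hm : n + 1 = m) (c : K.X n ⟶ T) (hc : K.d l n ≫ c = 0) :
    ∃ g : K.X m ⟶ T, K.d n m ≫ g = c := by
  have hl_exact := shortExact_iCycles_toCycles K l n hl (hK _)
  have hn_exact := shortExact_iCycles_toCycles K n m hm (hK _)
  have hm_exact := shortExact_iCycles_toCycles K m (m + 1) rfl (hK _)
  obtain ⟨c', hc'⟩ : ∃ c' : K.cycles m ⟶ T, K.toCycles n m ≫ c' = c := by
    have := hl_exact.epi_g
    have := hn_exact.epi_g
    have hc₀ : K.iCycles n ≫ c = 0 := by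
      rw [← cancel_epi (K.toCycles l n)]
      simpa using hc
    exact ⟨hn_exact.exact.desc c hc₀, hn_exact.exact.g_desc c hc₀⟩
  obtain ⟨g, hg⟩ : ∃ g : K.X m ⟶ T, K.iCycles m ≫ g = c' := by
    have := subsingleton_ext_cycles K N hK T hT (m + 1) 0
    obtain ⟨y, hy⟩ := Ext.contravariant_sequence_exact₁ hm_exact T (Ext.mk₀ c') rfl
      (Subsingleton.elim _ _)
    obtain ⟨g, rfl⟩ := Ext.homEquiv₀.symm.surjective y
    refine ⟨g, Ext.homEquiv₀.symm.injective ?_⟩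
    simpa [Ext.homEquiv₀] using hy
  exact ⟨g, by rw [← hc', ← hg, HomologicalComplex.toCycles_i_assoc]⟩

end ExtAcyclic

section MappingCone

open Abelian CochainComplex

variable {C : Type u} [Category.{v} C] [Abelian C] {K L : CochainComplex C ℤ} (f : K ⟶ L)

lemma quasiIso_iff_acyclic_mappingCone : QuasiIso f ↔ (mappingCone f).Acyclic := by
  rw [← HomotopyCategory.quotient_obj_mem_subcategoryAcyclic_iff_acyclic,
    ← HomologicalComplex.mem_quasiIso_iff, ← HomotopyCategory.quotient_map_mem_quasiIso_iff,
    HomotopyCategory.quasiIso_eq_trW_subcategoryAcyclic]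
  exact (HomotopyCategory.subcategoryAcyclic C).trW_iff_of_distinguished _
    (HomotopyCategory.mappingCone_triangleh_distinguished f)

instance isStrictlyLE_mappingCone (N : ℤ) [K.IsStrictlyLE N] [L.IsStrictlyLE N] :
    (mappingCone f).IsStrictlyLE N := by
  rw [isStrictlyLE_iff]
  intro i hi
  rw [mappingCone.isZero_X_iff]
  exact ⟨K.isZero_of_isStrictlyLE N _ (by lia), L.isZero_of_isStrictlyLE N _ hi⟩

lemma subsingleton_ext_mappingCone_X [HasExt.{w₁} C] (T : C) (n : ℕ)
    (hK : ∀ i, Subsingleton (Ext (K.X i) T n)) (hL : ∀ i, Subsingleton (Ext (L.X i) T n))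
    (i : ℤ) : Subsingleton (Ext ((mappingCone f).X i) T n) := by
  refine subsingleton_of_forall_eq 0 fun x => ?_
  have := hK (i + 1)
  have := hL i
  have hinl := Subsingleton.elim
    ((Ext.mk₀ ((mappingCone.inl f).v (i + 1) i (by lia))).comp x (zero_add n)) 0
  have hinr := Subsingleton.elim ((Ext.mk₀ ((mappingCone.inr f).f i)).comp x (zero_add n)) 0
  rw [← Ext.mk₀_id_comp x, ← mappingCone.id_X f i (i + 1) rfl, Ext.mk₀_add, Ext.add_comp,
    ← Ext.mk₀_comp_mk₀_assoc, ← Ext.mk₀_comp_mk₀_assoc, hinl, hinr, Ext.comp_zero, Ext.comp_zero,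
    add_zero]

end MappingCone

section ExactMap

variable {A : Type u₁} [Category.{v₁} A] [Abelian A] {B : Type u₂} [Category.{v₂} B] [Abelian B]
  {F : B ⥤ A} {G : A ⥤ B} [F.PreservesZeroMorphisms] [G.PreservesZeroMorphisms]

lemma exact_map_of_forall_exists_mono (adj : G ⊣ F) (S : ShortComplex A)
    (h : ∀ (Y : B) (c : S.X₂ ⟶ F.obj Y), S.f ≫ c = 0 →
      ∃ (Y' : B) (i : Y ⟶ Y') (g : S.X₃ ⟶ F.obj Y'), Mono i ∧ S.g ≫ g = c ≫ F.map i) :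
    (S.map G).Exact := by
  let c : G.obj S.X₂ ⟶ cokernel (G.map S.f) := cokernel.π _
  have hc : S.f ≫ adj.homEquiv _ _ c = 0 := by
    rw [← adj.homEquiv_naturality_left, cokernel.condition, adj.homEquiv_unit, F.map_zero,
      comp_zero]
  obtain ⟨Y', i, g, _, hg⟩ := h _ _ hc
  have hg' : G.map S.g ≫ (adj.homEquiv _ _).symm g = c ≫ i := by
    rw [← adj.homEquiv_naturality_left_symm, hg, adj.homEquiv_naturality_right_symm,
      Equiv.symm_apply_apply]
  have hι : kernel.ι (G.map S.g) ≫ c = 0 := zero_of_comp_mono i <| by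
    rw [Category.assoc, ← hg', kernel.condition_assoc, zero_comp]
  rwa [ShortComplex.exact_iff_kernel_ι_comp_cokernel_π_zero]

end ExactMap

section KProjective

open DerivedCategory CochainComplex

variable {C : Type u} [Category.{v} C] [Abelian C] [HasDerivedCategory.{w₁} C]
  (K L : CochainComplex C ℤ) [K.IsKProjective]

lemma Q_map_surjective : Function.Surjective (Q.map : (K ⟶ L) → _) := by
  intro f
  obtain ⟨g, hg⟩ :=
    (IsKProjective.Qh_map_bijective K ((HomotopyCategory.quotient _ _).obj L)).surjective
      ((quotientCompQhIso C).hom.app K ≫ f ≫ (quotientCompQhIso C).inv.app L)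
  obtain ⟨g, rfl⟩ := (HomotopyCategory.quotient _ _).map_surjective g
  refine ⟨g, ?_⟩
  rw [← cancel_epi ((quotientCompQhIso C).hom.app K), ← quotientCompQhIso_hom_naturality, hg]
  simp

variable {K L}

lemma Q_map_eq_iff_nonempty_homotopy {f g : K ⟶ L} :
    Q.map f = Q.map g ↔ Nonempty (Homotopy f g) := by
  refine ⟨fun h => ⟨HomotopyCategory.homotopyOfEq _ _
    ((IsKProjective.Qh_map_bijective K _).injective ?_)⟩, fun ⟨H⟩ => Q_map_eq_of_homotopy C H⟩
  rw [← cancel_mono ((quotientCompQhIso C).hom.app L), quotientCompQhIso_hom_naturality,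
    quotientCompQhIso_hom_naturality, h]

end KProjective

section Adjunction

/-- The adjunction between categories of homological complexes induced degreewise by an adjunction
between additive functors. -/
def mapHomologicalComplexAdjunction {C : Type u₁} [Category.{v₁} C] [Preadditive C]
    {D : Type u₂} [Category.{v₂} D] [Preadditive D] {G : C ⥤ D} {F : D ⥤ C} (adj : G ⊣ F)
    [G.Additive] [F.Additive] {ι : Type*} (c : ComplexShape ι) :
    G.mapHomologicalComplex c ⊣ F.mapHomologicalComplex c where
  unit :=
    { app := fun K =>
        { f := fun i => adj.unit.app (K.X i)
          comm' := fun i j _ => (adj.unit.naturality (K.d i j)).symm }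
      naturality := fun K L f => by ext i; exact adj.unit.naturality (f.f i) }
  counit :=
    { app := fun K =>
        { f := fun i => adj.counit.app (K.X i)
          comm' := fun i j _ => (adj.counit.naturality (K.d i j)).symm }
      naturality := fun K L f => by ext i; exact adj.counit.naturality (f.f i) }
  left_triangle_components K := by ext i; exact adj.left_triangle_components (K.X i)
  right_triangle_components K := by ext i; exact adj.right_triangle_components (K.X i)

variable {A : Type u₁} [Category.{v₁} A] [Abelian A] {B : Type u₂} [Category.{v₂} B] [Abelian B]
  {F : B ⥤ A} {G : A ⥤ B} [F.Additive] [G.Additive] (adj : G ⊣ F)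

section Ext

open Abelian CochainComplex

variable [HasExt.{w} A]

include adj in
lemma acyclic_map_of_subsingleton_ext (K : CochainComplex A ℤ) (N : ℤ) [K.IsStrictlyLE N]
    (hK : K.Acyclic)
    (h : ∀ (i : ℤ) (Y : B) (n : ℕ), Subsingleton (Ext (K.X i) (F.obj Y) (n + 1))) :
    ((G.mapHomologicalComplex (.up ℤ)).obj K).Acyclic := by
  intro n
  rw [HomologicalComplex.exactAt_iff' _ (n - 1) n (n + 1) (by simp) (by simp)]
  refine exact_map_of_forall_exists_mono adj (K.sc' (n - 1) n (n + 1)) fun Y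
    (c : K.X n ⟶ F.obj Y) (hc : K.d (n - 1) n ≫ c = 0) => ?_
  obtain ⟨g, hg⟩ := exists_d_comp_eq K N hK (F.obj Y) (fun i => h i Y) (by lia) rfl c hc
  have hg' : K.d n (n + 1) ≫ g = c ≫ F.map (𝟙 Y) := by rw [hg, F.map_id, Category.comp_id]
  exact ⟨Y, 𝟙 Y, g, inferInstance, hg'⟩

lemma quasiIso_homEquiv_symm [F.Full] [F.Faithful] (N : ℤ) {P : CochainComplex A ℤ}
    [P.IsStrictlyLE N] (hP : ∀ i, Projective (P.X i)) {E : CochainComplex B ℤ} [E.IsStrictlyLE N]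
    (hE : ∀ (i : ℤ) (Y : B) (n : ℕ), Subsingleton (Ext (F.obj (E.X i)) (F.obj Y) (n + 1)))
    (p : P ⟶ (F.mapHomologicalComplex (.up ℤ)).obj E) [QuasiIso p] :
    QuasiIso (((mapHomologicalComplexAdjunction adj (.up ℤ)).homEquiv _ _).symm p) := by
  have hcone : ((G.mapHomologicalComplex (.up ℤ)).obj (mappingCone p)).Acyclic :=
    acyclic_map_of_subsingleton_ext adj _ N ((quasiIso_iff_acyclic_mappingCone p).1 inferInstance)
      fun i Y n => subsingleton_ext_mappingCone_X p _ _
        (fun i => Ext.subsingleton_of_projective _ _ _) (fun i => hE i Y n) i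
  have hGp : QuasiIso ((G.mapHomologicalComplex (.up ℤ)).map p) := by
    rw [quasiIso_iff_acyclic_mappingCone]
    exact fun n => (hcone n).of_iso (mappingCone.mapHomologicalComplexIso p G)
  have (i : ℤ) : IsIso (((mapHomologicalComplexAdjunction adj (.up ℤ)).counit.app E).f i) :=
    inferInstanceAs (IsIso (adj.counit.app (E.X i)))
  have : IsIso ((mapHomologicalComplexAdjunction adj (.up ℤ)).counit.app E) :=
    HomologicalComplex.Hom.isIso_of_components _
  rw [Adjunction.homEquiv_counit]
  infer_instance

end Ext

lemma nonempty_homotopy_of_homotopy_homEquiv {K : CochainComplex A ℤ} {L : CochainComplex B ℤ}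
    {f g : (G.mapHomologicalComplex (.up ℤ)).obj K ⟶ L}
    (H : Homotopy ((mapHomologicalComplexAdjunction adj (.up ℤ)).homEquiv _ _ f)
      ((mapHomologicalComplexAdjunction adj (.up ℤ)).homEquiv _ _ g)) :
    Nonempty (Homotopy f g) := by
  let adj' := mapHomologicalComplexAdjunction adj (.up ℤ)
  have hadj (k : (G.mapHomologicalComplex (.up ℤ)).obj K ⟶ L) :
      (G.mapHomologicalComplex (.up ℤ)).map (adj'.homEquiv _ _ k) ≫ adj'.counit.app L = k :=
    (adj'.homEquiv_counit _ _ _).symm.trans (Equiv.symm_apply_apply _ _)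
  rw [← hadj f, ← hadj g]
  exact ⟨(G.mapHomotopy H).compRight (adj'.counit.app L)⟩

section DerivedCategory

open DerivedCategory CochainComplex

variable [PreservesFiniteLimits F] [PreservesFiniteColimits F]

lemma quasiIso_unit_app_of_quasiIso {K : CochainComplex A ℤ} {L : CochainComplex B ℤ}
    (f : K ⟶ (F.mapHomologicalComplex (.up ℤ)).obj L) [QuasiIso f]
    (hf : QuasiIso (((mapHomologicalComplexAdjunction adj (.up ℤ)).homEquiv _ _).symm f)) :
    QuasiIso ((mapHomologicalComplexAdjunction adj (.up ℤ)).unit.app K) := by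
  let adj' := mapHomologicalComplexAdjunction adj (.up ℤ)
  have hunit : adj'.unit.app K ≫
      (F.mapHomologicalComplex (.up ℤ)).map ((adj'.homEquiv _ _).symm f) = f :=
    (adj'.homEquiv_unit _ _ _).symm.trans (Equiv.apply_symm_apply _ _)
  have : QuasiIso (adj'.unit.app K ≫
      (F.mapHomologicalComplex (.up ℤ)).map ((adj'.homEquiv _ _).symm f)) := by rwa [hunit]
  exact quasiIso_of_comp_right _
    ((F.mapHomologicalComplex (.up ℤ)).map ((adj'.homEquiv _ _).symm f))

variable [HasDerivedCategory.{w₁} A] [HasDerivedCategory.{w₂} B]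

lemma Q_map_homEquiv {K : CochainComplex A ℤ} {L : CochainComplex B ℤ}
    (f : (G.mapHomologicalComplex (.up ℤ)).obj K ⟶ L) :
    Q.map ((mapHomologicalComplexAdjunction adj (.up ℤ)).homEquiv _ _ f) =
      Q.map ((mapHomologicalComplexAdjunction adj (.up ℤ)).unit.app K) ≫
        F.mapDerivedCategoryFactors.inv.app _ ≫ F.mapDerivedCategory.map (Q.map f) ≫
          F.mapDerivedCategoryFactors.hom.app L := by
  rw [F.mapDerivedCategoryFactors_hom_naturality, Iso.inv_hom_id_app_assoc, ← Q.map_comp,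
    Adjunction.homEquiv_unit]

include adj in
lemma mapDerivedCategory_map_bijective (K : CochainComplex A ℤ) [K.IsKProjective]
    [IsKProjective ((G.mapHomologicalComplex (.up ℤ)).obj K)]
    (hK : QuasiIso ((mapHomologicalComplexAdjunction adj (.up ℤ)).unit.app K))
    (L : CochainComplex B ℤ) :
    Function.Bijective (F.mapDerivedCategory.map :
      (Q.obj ((G.mapHomologicalComplex (.up ℤ)).obj K) ⟶ Q.obj L) → _) := by
  let adj' := mapHomologicalComplexAdjunction adj (.up ℤ)
  have : IsIso (Q.map (adj'.unit.app K)) := (isIso_Q_map_iff_quasiIso _ _).2 hK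
  constructor
  · intro f g hfg
    obtain ⟨f, rfl⟩ := Q_map_surjective _ _ f
    obtain ⟨g, rfl⟩ := Q_map_surjective _ _ g
    have hQ : Q.map (adj'.homEquiv _ _ f) = Q.map (adj'.homEquiv _ _ g) := by
      rw [Q_map_homEquiv, Q_map_homEquiv, hfg]
    obtain ⟨H⟩ := Q_map_eq_iff_nonempty_homotopy.1 hQ
    exact Q_map_eq_iff_nonempty_homotopy.2 (nonempty_homotopy_of_homotopy_homEquiv adj H)
  · intro g
    obtain ⟨g', hg'⟩ := Q_map_surjective K _ (Q.map (adj'.unit.app K) ≫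
      F.mapDerivedCategoryFactors.inv.app _ ≫ g ≫ F.mapDerivedCategoryFactors.hom.app L)
    refine ⟨Q.map ((adj'.homEquiv _ _).symm g'), ?_⟩
    have h := Q_map_homEquiv adj ((adj'.homEquiv _ _).symm g')
    rw [Equiv.apply_symm_apply, hg'] at h
    exact ((cancel_mono _).1 ((cancel_epi _).1 ((cancel_epi _).1 h))).symm

include adj in
lemma mapDerivedCategory_map_bijective_of_isLE [F.Full] [F.Faithful] [EnoughProjectives A]
    [HasExt.{w} A]
    (hF : ∀ P : B, Projective P → ∀ (Y : B) (n : ℕ),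
      Subsingleton (Abelian.Ext (F.obj P) (F.obj Y) (n + 1)))
    (X Y : DerivedCategory B) (N : ℤ) [X.IsLE N] :
    Function.Bijective (F.mapDerivedCategory.map : (X ⟶ Y) → _) := by
  have := enoughProjectives_of_faithful adj
  obtain ⟨K, hK, ⟨eX⟩⟩ := X.exists_iso_Q_obj_of_isLE N
  obtain ⟨E, ε, _, hE, _⟩ := exists_quasiIso_of_projective K N
  obtain ⟨P, p, _, hP, _⟩ :=
    exists_quasiIso_of_projective ((F.mapHomologicalComplex (.up ℤ)).obj E) N
  have hp := quasiIso_homEquiv_symm adj N hP (fun i => hF _ (hE i)) p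
  have hGP (i : ℤ) : Projective (((G.mapHomologicalComplex (.up ℤ)).obj P).X i) :=
    adj.map_projective _ (hP i)
  have := isKProjective_of_projective P N
  have := isKProjective_of_projective ((G.mapHomologicalComplex (.up ℤ)).obj P) N
  let q := ((mapHomologicalComplexAdjunction adj (.up ℤ)).homEquiv _ _).symm p
  exact map_bijective_of_iso _ (asIso (Q.map (q ≫ ε)) ≪≫ eX.symm) (Q.objObjPreimageIso Y)
    (mapDerivedCategory_map_bijective adj P (quasiIso_unit_app_of_quasiIso adj p hp) _)

end DerivedCategory

end Adjunction

section LeftDerived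

open Abelian

lemma quasiIso_toSingle₀Equiv_symm {C : Type u} [Category.{v} C] [Abelian C]
    (K : ChainComplex C ℕ) {X : C} (f : K.X 0 ⟶ X) (w : K.d 1 0 ≫ f = 0)
    (hf : (ShortComplex.mk (K.d 1 0) f w).Exact ∧ Epi f) (hK : ∀ n, K.ExactAt (n + 1)) :
    QuasiIso ((ChainComplex.toSingle₀Equiv K X).symm ⟨f, w⟩) where
  quasiIsoAt
    | 0 => by
      rw [ChainComplex.quasiIsoAt₀_iff, ShortComplex.quasiIso_iff_of_zeros'
        _ (K.shape _ _ (by simp)) rfl rfl]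
      have hπ := ChainComplex.toSingle₀Equiv_symm_apply_f_zero f w
      refine (ShortComplex.exact_and_epi_g_iff_of_iso
        (S₂ := ShortComplex.mk (K.d 1 0) f w) ?_).2 hf
      exact ShortComplex.isoMk (Iso.refl _) (Iso.refl _) (Iso.refl _)
        ((Category.id_comp _).trans (Category.comp_id _).symm)
        ((Category.id_comp _).trans (hπ.symm.trans (Category.comp_id _).symm))
    | n + 1 => by
      rw [quasiIsoAt_iff_exactAt' _ _ (ChainComplex.exactAt_succ_single_obj _ _)]
      exact hK n

variable {A : Type u₁} [Category.{v₁} A] [Abelian A] {B : Type u₂} [Category.{v₂} B] [Abelian B]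
  {F : B ⥤ A} {G : A ⥤ B} [G.Additive]

/-- The image of a projective resolution under a right exact functor that preserves projective
objects, as a projective resolution of the image, when it is exact in positive degrees. -/
noncomputable def projectiveResolutionMap {X : A} (R : ProjectiveResolution X) (G : A ⥤ B)
    [G.Additive] [G.PreservesProjectiveObjects] [PreservesFiniteColimits G]
    (hR : ∀ n, ((G.mapHomologicalComplex (.down ℕ)).obj R.complex).ExactAt (n + 1)) :
    ProjectiveResolution (G.obj X) :=
  have w : G.map (R.complex.d 1 0) ≫ G.map (R.π.f 0) = 0 := by
    rw [← G.map_comp, R.complex_d_comp_π_f_zero, G.map_zero]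
  { complex := (G.mapHomologicalComplex (.down ℕ)).obj R.complex
    projective := fun n => G.projective_obj_of_projective (R.projective n)
    π := (ChainComplex.toSingle₀Equiv _ _).symm ⟨G.map (R.π.f 0), w⟩
    quasiIso := quasiIso_toSingle₀Equiv_symm _ _ w
      ((ShortComplex.exact_and_epi_g_iff_g_is_cokernel (ShortComplex.mk _ _ w)).2
        ⟨CokernelCofork.mapIsColimit _ R.isColimitCokernelCofork G⟩) hR }

lemma isZero_leftDerived_obj_iff [EnoughProjectives A] {X : A} (R : ProjectiveResolution X)
    (n : ℕ) :
    IsZero ((G.leftDerived n).obj X) ↔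
      ((G.mapHomologicalComplex (.down ℕ)).obj R.complex).ExactAt n := by
  rw [HomologicalComplex.exactAt_iff_isZero_homology]
  exact (R.isoLeftDerivedObj G n).isZero_iff

variable (adj : G ⊣ F)

include adj in
lemma subsingleton_ext_of_isZero_leftDerived [EnoughProjectives A] [HasExt.{w} A]
    [F.PreservesEpimorphisms] (X : A) [Projective (G.obj X)]
    (h : ∀ n : ℕ, IsZero ((G.leftDerived (n + 1)).obj X)) (Y : B) (n : ℕ) :
    Subsingleton (Ext X (F.obj Y) (n + 1)) := by
  have : HasExt.{max u₂ v₂} B := HasExt.standard B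
  have : G.PreservesProjectiveObjects :=
    Functor.preservesProjectiveObjects_of_adjunction_of_preservesEpimorphisms adj
  have : PreservesFiniteColimits G :=
    adj.leftAdjoint_preservesColimits.{0, 0}.preservesFiniteColimits
  let R := projectiveResolution X
  let R' := projectiveResolutionMap R G fun n => (isZero_leftDerived_obj_iff R (n + 1)).1 (h n)
  refine subsingleton_of_forall_eq 0 fun x => ?_
  obtain ⟨f, hf, rfl⟩ := R.extMk_surjective x (n + 2) rfl
  let f' : R'.complex.X (n + 1) ⟶ Y := (adj.homEquiv _ _).symm f
  have hf' : R'.complex.d (n + 2) (n + 1) ≫ f' = 0 := by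
    refine (adj.homEquiv_naturality_left_symm _ _).symm.trans ?_
    rw [hf, adj.homEquiv_counit, G.map_zero, zero_comp]
    rfl
  obtain ⟨g, hg⟩ := (R'.extMk_eq_zero_iff f' (n + 2) rfl hf' n rfl).1
    (Ext.eq_zero_of_projective _)
  refine (R.extMk_eq_zero_iff f (n + 2) rfl hf n rfl).2 ⟨adj.homEquiv _ _ g, ?_⟩
  exact (adj.homEquiv_naturality_left _ _).symm.trans ((adj.homEquiv _ _).eq_symm_apply.1 hg)

include adj in
lemma isZero_leftDerived_succ_of_effaceable [F.PreservesZeroMorphisms] [EnoughProjectives A]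
    [HasExt.{w} A] (X : A) (n : ℕ)
    (h : ∀ (Y : B) (x : Ext X (F.obj Y) (n + 1)), ∃ (Y' : B) (i : Y ⟶ Y'),
      Mono i ∧ x.comp (Ext.mk₀ (F.map i)) (add_zero _) = 0) :
    IsZero ((G.leftDerived (n + 1)).obj X) := by
  let R := projectiveResolution X
  rw [isZero_leftDerived_obj_iff R, HomologicalComplex.exactAt_iff' _ (n + 2) (n + 1) n (by simp)
    (by simp)]
  refine exact_map_of_forall_exists_mono adj (R.complex.sc' (n + 2) (n + 1) n) fun Y
    (c : R.complex.X (n + 1) ⟶ F.obj Y) (hc : R.complex.d (n + 2) (n + 1) ≫ c = 0) => ?_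
  obtain ⟨Y', i, hi, hx⟩ := h Y (R.extMk c (n + 2) rfl hc)
  rw [R.extMk_comp_mk₀, R.extMk_eq_zero_iff _ _ _ _ n rfl] at hx
  obtain ⟨g, hg⟩ := hx
  exact ⟨Y', i, g, hi, hg⟩

end LeftDerived

section Effaceable

open Abelian

variable {C : Type u} [Category.{v} C] [Abelian C] [HasExt.{w} C]

lemma exists_mono_extClass_comp_eq_zero {S : ShortComplex C} (hS : S.ShortExact) {Y : C}
    (f : S.X₁ ⟶ Y) :
    ∃ (Y' : C) (i : Y ⟶ Y'), Mono i ∧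
      (hS.extClass.comp (Ext.mk₀ f) (add_zero 1)).comp (Ext.mk₀ i) (add_zero 1) = 0 := by
  have := hS.mono_f
  refine ⟨pushout S.f f, pushout.inr _ _, inferInstance, ?_⟩
  rw [Ext.comp_assoc_of_third_deg_zero, Ext.mk₀_comp_mk₀, ← pushout.condition,
    ← Ext.mk₀_comp_mk₀, hS.extClass_comp_assoc]

lemma exists_mono_comp_mk₀_eq_zero [EnoughProjectives C] (n : ℕ) {X Y : C} (x : Ext X Y (n + 1)) :
    ∃ (Y' : C) (i : Y ⟶ Y'), Mono i ∧ x.comp (Ext.mk₀ i) (add_zero _) = 0 := by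
  induction n generalizing X with
  | zero =>
    let S := ShortComplex.mk _ _ (kernel.condition (Projective.π X))
    have hS : S.ShortExact := { exact := ShortComplex.exact_of_f_is_kernel _ (kernelIsKernel S.g) }
    obtain ⟨x', rfl⟩ := Ext.contravariant_sequence_exact₃ hS Y x (Ext.eq_zero_of_projective _)
      (add_zero 1)
    obtain ⟨f, rfl⟩ := Ext.homEquiv₀.symm.surjective x'
    exact exists_mono_extClass_comp_eq_zero hS f
  | succ n ih =>
    let S := ShortComplex.mk _ _ (kernel.condition (Projective.π X))
    have hS : S.ShortExact := { exact := ShortComplex.exact_of_f_is_kernel _ (kernelIsKernel S.g) }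
    obtain ⟨x', rfl⟩ := Ext.contravariant_sequence_exact₃ hS Y x (Ext.eq_zero_of_projective _)
      (Nat.add_comm 1 (n + 1))
    obtain ⟨Y', i, hi, hx'⟩ := ih x'
    refine ⟨Y', i, hi, ?_⟩
    rw [Ext.comp_assoc_of_third_deg_zero, hx', Ext.comp_zero]

end Effaceable

section MapExt

open Abelian DerivedCategory

variable {A : Type u₁} [Category.{v₁} A] [Abelian A] {B : Type u₂} [Category.{v₂} B] [Abelian B]
  {F : B ⥤ A} [F.Additive] [PreservesFiniteLimits F] [PreservesFiniteColimits F]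
  [HasExt.{w} A] [HasExt.{w'} B]

lemma mapExactFunctor_surjective_of_mapDerivedCategory_map_surjective
    [HasDerivedCategory.{w₁} A] [HasDerivedCategory.{w₂} B] {X Y : B} {n : ℕ}
    (h : Function.Surjective (F.mapDerivedCategory.map :
      ((singleFunctor B 0).obj X ⟶ ((singleFunctor B 0).obj Y)⟦(n : ℤ)⟧) → _)) :
    Function.Surjective (Ext.mapExactFunctor F : Ext X Y n → _) := by
  intro x
  let e := F.mapDerivedCategorySingleFunctor 0
  obtain ⟨β, hβ⟩ := h (e.hom.app X ≫ x.hom ≫ (e.inv.app Y)⟦(n : ℤ)⟧' ≫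
    (F.mapDerivedCategory.commShiftIso _).inv.app _)
  refine ⟨Ext.homEquiv.symm β, ?_⟩
  ext
  rw [Ext.mapExactFunctor_hom, Ext.hom, Ext.hom, Equiv.apply_symm_apply, ShiftedHom.map, hβ]
  dsimp only [e]
  simp [← Functor.map_comp]

lemma isZero_leftDerived_of_mapExactFunctor_surjective {G : A ⥤ B} [G.Additive] (adj : G ⊣ F)
    [EnoughProjectives A] [EnoughProjectives B] {X : B} {n : ℕ}
    (h : ∀ Y : B, Function.Surjective (Ext.mapExactFunctor F : Ext X Y (n + 1) → _)) :
    IsZero ((G.leftDerived (n + 1)).obj (F.obj X)) := by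
  refine isZero_leftDerived_succ_of_effaceable adj _ n fun Y x => ?_
  obtain ⟨x, rfl⟩ := h Y x
  obtain ⟨Y', i, hi, hx⟩ := exists_mono_comp_mk₀_eq_zero n x
  refine ⟨Y', i, hi, ?_⟩
  rw [← Ext.mapExactFunctor_mk₀, ← Ext.mapExactFunctor_comp, hx, Ext.mapExactFunctor_zero]

end MapExt

section MinusBounded

open DerivedCategory

variable {B : Type u₂} [Category.{v₂} B] [Abelian B] [HasDerivedCategory.{w₂} B]

lemma bounded_singleFunctor_obj (X : B) : TStructure.t.bounded ((singleFunctor B 0).obj X) :=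
  ⟨⟨0, inferInstance⟩, ⟨0, inferInstance⟩⟩

variable {A : Type u₁} [Category.{v₁} A] [Abelian A] [HasDerivedCategory.{w₁} A]
  (F : B ⥤ A) [F.Additive] [PreservesFiniteLimits F] [PreservesFiniteColimits F]

lemma mapDerivedMinus_full_and_faithful_iff :
    (mapDerivedMinus F).Full ∧ (mapDerivedMinus F).Faithful ↔
      ∀ X Y : DerivedCategory B, TStructure.t.minus X → TStructure.t.minus Y →
        Function.Bijective (F.mapDerivedCategory.map : (X ⟶ Y) → _) :=
  full_and_faithful_lift_ι_comp_iff F.mapDerivedCategory _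

lemma mapDerivedBounded_full_and_faithful_iff :
    (mapDerivedBounded F).Full ∧ (mapDerivedBounded F).Faithful ↔
      ∀ X Y : DerivedCategory B, TStructure.t.bounded X → TStructure.t.bounded Y →
        Function.Bijective (F.mapDerivedCategory.map : (X ⟶ Y) → _) :=
  full_and_faithful_lift_ι_comp_iff F.mapDerivedCategory _

end MinusBounded

end ReflectiveAbelian

open ReflectiveAbelian in
theorem mainTheorem6_general {A : Type u₁} [Category.{v₁} A] [Abelian A] [EnoughProjectives A]
    {B : Type u₂} [Category.{v₂} B] [Abelian B] {F : B ⥤ A} {G : A ⥤ B} (adj : G ⊣ F)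
    [F.Full] [F.Faithful] [F.Additive] [G.Additive]
    [PreservesFiniteLimits F] [PreservesFiniteColimits F]
    [HasDerivedCategory.{w₁} B] [HasDerivedCategory.{w₂} A] :
    List.TFAE
      [∀ P : B, Projective P → ∀ n : ℕ, 1 ≤ n → IsZero ((G.leftDerived n).obj (F.obj P)),
        ∀ X : B, ∀ n : ℕ, 1 ≤ n → IsZero ((G.leftDerived n).obj (F.obj X)),
        (mapDerivedMinus F).Full ∧ (mapDerivedMinus F).Faithful,
        (mapDerivedBounded F).Full ∧ (mapDerivedBounded F).Faithful] := by
  have : HasExt.{max u₁ v₁} A := HasExt.standard A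
  have : HasExt.{max u₂ v₂} B := HasExt.standard B
  have : EnoughProjectives B := enoughProjectives_of_faithful adj
  rw [mapDerivedMinus_full_and_faithful_iff, mapDerivedBounded_full_and_faithful_iff]
  tfae_have 1 → 3 := by
    rintro h X Y ⟨N, _ : X.IsLE N⟩ -
    refine mapDerivedCategory_map_bijective_of_isLE adj (fun P hP => ?_) X Y N
    have : Projective (G.obj (F.obj P)) := hP.of_iso (asIso (adj.counit.app P)).symm
    exact subsingleton_ext_of_isZero_leftDerived adj _ fun n => h P hP (n + 1) n.succ_pos
  tfae_have 3 → 4 := fun h X Y hX hY => h X Y hX.2 hY.2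
  tfae_have 4 → 2
    | h, X, n + 1, _ => by
      refine isZero_leftDerived_of_mapExactFunctor_surjective adj fun Y =>
        mapExactFunctor_surjective_of_mapDerivedCategory_map_surjective (h _ _ ?_ ?_).surjective
      · exact bounded_singleFunctor_obj X
      · exact DerivedCategory.TStructure.t.bounded.le_shift _ _ (bounded_singleFunctor_obj Y)
  tfae_have 2 → 1 := fun h P _ => h P
  tfae_finish

theorem mainTheorem6 {A : Type u} [Category.{v} A] [Abelian A]
    [EnoughProjectives A] (B : ObjectProperty A) [B.IsClosedUnderKernels]
    [B.IsClosedUnderCokernels] [Reflective B.ι]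
    [HasDerivedCategory.{w₁} B.FullSubcategory] [HasDerivedCategory.{w₂} A] :
    List.TFAE
      [∀ P : B.FullSubcategory, Projective P → ∀ n : ℕ, 1 ≤ n →
          IsZero (((reflector B.ι).leftDerived n).obj P.obj),
        ∀ X : B.FullSubcategory, ∀ n : ℕ, 1 ≤ n →
          IsZero (((reflector B.ι).leftDerived n).obj X.obj),
        (ReflectiveAbelian.mapDerivedMinus B.ι).Full ∧
          (ReflectiveAbelian.mapDerivedMinus B.ι).Faithful,
        (ReflectiveAbelian.mapDerivedBounded B.ι).Full ∧
          (ReflectiveAbelian.mapDerivedBounded B.ι).Faithful] :=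
  mainTheorem6_general (reflectorAdjunction B.ι)
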